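/- **Noether's theorem for dissipative systems.** Let $Q$ be a finite-dimensional smooth manifold without boundary, with tangent bundle $\tau\colon TQ\to Q$ and bundle coordinates $(q^i,\dot q^i)$. Let $S=\mathrm{d}q^i\otimes\partial/\partial\dot q^i$ be the vertical endomorphism and $\Delta=\dot q^i\,\partial/\partial\dot q^i$ the Liouville vector field of $TQ$. For a vector field $X=X^i\,\partial/\partial q^i$ on $Q$, let $$X^v=X^i\frac{\partial}{\partial\dot q^i},\qquad X^c=X^i\frac{\partial}{\partial q^i}+\dot q^j\frac{\partial X^i}{\partial q^j}\frac{\partial}{\partial\dot q^i}$$ be its vertical and complete lifts to $TQ$. Let $L\colon TQ\to\mathbb{R}$ be a smooth regular Lagrangian, i.e. the Hessian matrix $\left(\partial^2L/\partial\dot q^i\partial\dot q^j\right)$ is invertible at every point of $TQ$, and let $\beta$ be a smooth semibasic 1-form on $TQ$ (an external force), i.e. a 1-form vanishing on all vertical vectors. Put $\alpha_L=S^*(\mathrm{d}L)$, $\omega_L=-\mathrm{d}\alpha_L$ and $E_L=\Delta(L)-L$. Then there is exactly one vector field $\xi_{L,\beta}$ on $TQ$ (the forced Euler–Lagrange vector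 field) with $$\iota_{\xi_{L,\beta}}\omega_L=\mathrm{d}E_L+\beta ,$$ and for every smooth vector field $X$ on $Q$ one has $$X^c(L)=\beta(X^c)\ \text{ on } TQ\quad\Longleftrightarrow\quad X^v(L)\text{ is a constant of the motion, i.e. } \xi_{L,\beta}\bigl(X^v(L)\bigr)=0\ \text{ on } TQ .$$ More precisely, $\xi_{L,\beta}\bigl(X^v(L)\bigr)=X^c(L)-\beta(X^c)$. -/

import Mathlib

open scoped Manifold ContDiff

noncomputable section

namespace ForcedLagrangian

/-! ### Differential forms on a manifold without boundary -/

section Forms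

variable {F : Type*} [NormedAddCommGroup F] [NormedSpace ℝ F]
  {H : Type*} [TopologicalSpace H] (I : ModelWithCorners ℝ F H)
  {M : Type*} [TopologicalSpace M] [ChartedSpace H M]

/-- The coordinate expression of a 1-form `α` in the preferred chart at `p`, i.e. the pullback of
`α` under the inverse of that chart, as a 1-form on (an open subset of) the model vector space. -/
def oneFormInChart (α : ∀ x : M, TangentSpace I x →L[ℝ] ℝ) (p : M) (y : F) : F →L[ℝ] ℝ :=
  (α ((extChartAt I p).symm y)).comp (mfderiv 𝓘(ℝ, F) I (extChartAt I p).symm y)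

/-- The exterior derivative `dα` of a 1-form `α` on a manifold without boundary, computed at `p` in
the preferred chart at `p`. That chart is also the one through which `TangentSpace I p` is
identified with the model vector space `F`, so no change of coordinates is needed afterwards.
The convention is `dα(U, W) = U (α W) - W (α U) - α [U, W]`. -/
def extDerivOneForm (α : ∀ x : M, TangentSpace I x →L[ℝ] ℝ) (p : M) :
    TangentSpace I p [⋀^Fin 2]→L[ℝ] ℝ :=
  extDeriv (E := F) (fun y : F =>
    ContinuousAlternatingMap.ofSubsingleton ℝ F ℝ (0 : Fin 1) (oneFormInChart I α p y))
    (extChartAt I p p)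

variable [IsManifold I 1 M]

/-- A 1-form is smooth if it is a smooth section of the cotangent bundle. -/
def IsSmoothOneForm (α : ∀ x : M, TangentSpace I x →L[ℝ] ℝ) : Prop :=
  ContMDiff I (I.prod 𝓘(ℝ, F →L[ℝ] ℝ)) ∞ (fun x => Bundle.TotalSpace.mk' (F →L[ℝ] ℝ)
    (E := fun x : M => TangentSpace I x →L[ℝ] Bundle.Trivial M ℝ x) x (α x))

end Forms

/-! ### The geometry of the tangent bundle -/

variable {E : Type*} [NormedAddCommGroup E] [NormedSpace ℝ E]
  {Q : Type*} [TopologicalSpace Q] [ChartedSpace E Q] [IsManifold 𝓘(ℝ, E) ∞ Q]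

/-- A vector field on `Q` is smooth if it is a smooth section of the tangent bundle. -/
def IsSmoothVectorField (X : ∀ q : Q, TangentSpace 𝓘(ℝ, E) q) : Prop :=
  ContMDiff 𝓘(ℝ, E) 𝓘(ℝ, E).tangent ∞
    (fun q => (⟨q, X q⟩ : TangentBundle 𝓘(ℝ, E) Q))

/-- The derivative `Tτ : T_v(TQ) → T_{τ(v)}Q` of the projection `τ : TQ → Q`. -/
def projDeriv (v : TangentBundle 𝓘(ℝ, E) Q) :
    TangentSpace 𝓘(ℝ, E).tangent v →L[ℝ] TangentSpace 𝓘(ℝ, E) v.proj :=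
  mfderiv 𝓘(ℝ, E).tangent 𝓘(ℝ, E)
    (fun w : TangentBundle 𝓘(ℝ, E) Q => w.proj) v

/-- The inclusion `T_qQ → TQ` of the fibre over `q`. (`TangentSpace 𝓘(ℝ, E) q` is by definition a
copy of the vector space `E`, written as such here because derivatives on it are taken.) -/
def fibreIncl (q : Q) (x : E) : TangentBundle 𝓘(ℝ, E) Q :=
  ⟨q, (x : TangentSpace 𝓘(ℝ, E) q)⟩

/-- The canonical isomorphism of `T_qQ`, `q = τ(v)`, onto the vertical space at `v`: the derivative
at `v` of the inclusion `T_qQ → TQ` of the fibre. It sends `w` to the velocity of `v + t w` at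
`t = 0`. -/
def fibreLift (v : TangentBundle 𝓘(ℝ, E) Q) :
    TangentSpace 𝓘(ℝ, E) v.proj →L[ℝ] TangentSpace 𝓘(ℝ, E).tangent v :=
  mfderiv 𝓘(ℝ, E) 𝓘(ℝ, E).tangent (fibreIncl (E := E) v.proj) v.2

/-- The vertical endomorphism `S = dqⁱ ⊗ ∂/∂q̇ⁱ` of `TQ`. -/
def verticalEndomorphism (v : TangentBundle 𝓘(ℝ, E) Q) :
    TangentSpace 𝓘(ℝ, E).tangent v →L[ℝ] TangentSpace 𝓘(ℝ, E).tangent v :=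
  (fibreLift v).comp (projDeriv v)

/-- The Liouville vector field `Δ = q̇ⁱ ∂/∂q̇ⁱ` of `TQ`. -/
def liouville (v : TangentBundle 𝓘(ℝ, E) Q) : TangentSpace 𝓘(ℝ, E).tangent v :=
  fibreLift v v.2

/-- The vertical lift `X^v = Xⁱ ∂/∂q̇ⁱ` of a vector field `X = Xⁱ ∂/∂qⁱ` on `Q`. -/
def verticalLift (X : ∀ q : Q, TangentSpace 𝓘(ℝ, E) q) (v : TangentBundle 𝓘(ℝ, E) Q) :
    TangentSpace 𝓘(ℝ, E).tangent v :=
  fibreLift v (X v.proj)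

/-- The complete lift `X^c = Xⁱ ∂/∂qⁱ + q̇ʲ (∂Xⁱ/∂qʲ) ∂/∂q̇ⁱ` of a vector field `X = Xⁱ ∂/∂qⁱ`
on `Q`, at a point `v` over `q`. The coordinates are the bundle coordinates `(qⁱ, q̇ⁱ)` of `TQ`
induced by the preferred chart of `Q` at `q`; they are the ones through which
`TangentSpace 𝓘(ℝ, E).tangent v` is identified with `E × E`. The coordinate expression of `X` is
its pullback under the inverse of the chart. -/
def completeLift (X : ∀ q : Q, TangentSpace 𝓘(ℝ, E) q) (v : TangentBundle 𝓘(ℝ, E) Q) :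
    TangentSpace 𝓘(ℝ, E).tangent v :=
  ((X v.proj,
    fderiv ℝ
      (fun y : E =>
        (VectorField.mpullback 𝓘(ℝ, E) 𝓘(ℝ, E) (extChartAt 𝓘(ℝ, E) v.proj).symm X y : E))
      (extChartAt 𝓘(ℝ, E) v.proj v.proj) v.2) : E × E)

/-- A 1-form on `TQ` is semibasic if it vanishes on vertical vectors. -/
def IsSemibasic
    (β : ∀ v : TangentBundle 𝓘(ℝ, E) Q, TangentSpace 𝓘(ℝ, E).tangent v →L[ℝ] ℝ) : Prop :=
  ∀ (v : TangentBundle 𝓘(ℝ, E) Q) (u : TangentSpace 𝓘(ℝ, E).tangent v),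
    projDeriv v u = 0 → β v u = 0

/-! ### Lagrangian systems with external forces -/

/-- The derivative `Y(f)` of a function `f` on `TQ` along a vector field `Y` on `TQ`. -/
def lieDeriv (Y : ∀ v : TangentBundle 𝓘(ℝ, E) Q, TangentSpace 𝓘(ℝ, E).tangent v)
    (f : TangentBundle 𝓘(ℝ, E) Q → ℝ) (v : TangentBundle 𝓘(ℝ, E) Q) : ℝ :=
  mvfderiv 𝓘(ℝ, E).tangent f v (Y v)

/-- The fibre Hessian `W = (∂²L/∂q̇ⁱ∂q̇ʲ)` of `L` at `v`, as a linear map from `T_qQ` to its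
dual: the second derivative at `v` of the restriction of `L` to the fibre `T_qQ`. -/
def fibreHessian (L : TangentBundle 𝓘(ℝ, E) Q → ℝ) (v : TangentBundle 𝓘(ℝ, E) Q) :
    E →L[ℝ] E →L[ℝ] ℝ :=
  fderiv ℝ (fderiv ℝ (fun x : E => L (fibreIncl (E := E) v.proj x))) v.2

/-- `L` is regular if its fibre Hessian is invertible at every point. -/
def IsRegular (L : TangentBundle 𝓘(ℝ, E) Q → ℝ) : Prop :=
  ∀ v : TangentBundle 𝓘(ℝ, E) Q, (fibreHessian L v).IsInvertible

/-- The Poincaré–Cartan 1-form `α_L = S^*(dL)`. -/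
def cartanOneForm (L : TangentBundle 𝓘(ℝ, E) Q → ℝ) (v : TangentBundle 𝓘(ℝ, E) Q) :
    TangentSpace 𝓘(ℝ, E).tangent v →L[ℝ] ℝ :=
  (mvfderiv 𝓘(ℝ, E).tangent L v).comp (verticalEndomorphism v)

/-- The Poincaré–Cartan 2-form `ω_L = -dα_L`. -/
def cartanTwoForm (L : TangentBundle 𝓘(ℝ, E) Q → ℝ) (v : TangentBundle 𝓘(ℝ, E) Q) :
    TangentSpace 𝓘(ℝ, E).tangent v [⋀^Fin 2]→L[ℝ] ℝ :=
  -extDerivOneForm 𝓘(ℝ, E).tangent (cartanOneForm L) v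

/-- The energy `E_L = Δ(L) - L`. -/
def energy (L : TangentBundle 𝓘(ℝ, E) Q → ℝ) (v : TangentBundle 𝓘(ℝ, E) Q) : ℝ :=
  lieDeriv liouville L v - L v

/-- `ξ` is a forced Euler–Lagrange vector field of `(L, β)`, i.e. it solves
`i_ξ ω_L = dE_L + β`. -/
def IsForcedEulerLagrange (L : TangentBundle 𝓘(ℝ, E) Q → ℝ)
    (β : ∀ v : TangentBundle 𝓘(ℝ, E) Q, TangentSpace 𝓘(ℝ, E).tangent v →L[ℝ] ℝ)
    (ξ : ∀ v : TangentBundle 𝓘(ℝ, E) Q, TangentSpace 𝓘(ℝ, E).tangent v) : Prop :=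
  ∀ (v : TangentBundle 𝓘(ℝ, E) Q) (u : TangentSpace 𝓘(ℝ, E).tangent v),
    cartanTwoForm L v ![ξ v, u] = mvfderiv 𝓘(ℝ, E).tangent (energy L) v u + β v u

/-- `f` is a constant of the motion of the vector field `ξ` if `ξ(f) = 0`. -/
def IsConstantOfMotion
    (ξ : ∀ v : TangentBundle 𝓘(ℝ, E) Q, TangentSpace 𝓘(ℝ, E).tangent v)
    (f : TangentBundle 𝓘(ℝ, E) Q → ℝ) : Prop :=
  ∀ v : TangentBundle 𝓘(ℝ, E) Q, lieDeriv ξ f v = 0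

end ForcedLagrangian

end

/-!
The identity is local, and at a point `v` of `TQ` everything can be read in the preferred chart at
`v`, through which `TangentSpace 𝓘(ℝ, E).tangent v` is by definition `E × E`. Write `param v` for the
inverse of this chart and `ℓ = L ∘ param v` for the coordinate expression of `L`, a function of
`(x, y) = (qⁱ, q̇ⁱ)`. The key point is that `Tτ` and the fibre lift have the expected coordinate
expressions `(δx, δy) ↦ δx` and `a ↦ (0, a)` at all points of the chart, not only at its base point
(`projDeriv_paramDeriv`, `fibreLift_baseParamDeriv`). Hence `α_L`, `E_L` and `X^v(L)` are given near
the base point by `Dℓ(0, δx)`, `Dℓ(0, y) - ℓ` and `Dℓ(0, X)`, and can be differentiated. With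
`H = D²ℓ`, the equation `i_ξ ω_L = dE_L + β` becomes
`H u (0, ξ₁) - H ξ (0, u₁) = H u (0, y) - Dℓ(u₁, 0) + β(u₁, 0)` for all `u`,
the form `β` being semibasic. For vertical `u` it says `ξ₁ = y`, because the vertical block of `H` is
the fibre Hessian, which is injective. What remains is the system of forced Euler–Lagrange equations
`H ξ (0, w) = Dℓ(w, 0) - β(w, 0)` (`eulerLagrange_at_iff`). Since `ξ₁` is known, the equations are
linear in `ξ₂` with invertible matrix, so there is exactly one solution
(`existsUnique_eulerLagrange_at`). Finally
`ξ(X^v(L)) = H ξ (0, X) + Dℓ(0, DX y) = Dℓ(X, DX y) - β(X, 0) = X^c(L) - β(X^c)`.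
-/

noncomputable section

namespace ForcedLagrangian

variable {E : Type*} [NormedAddCommGroup E] [NormedSpace ℝ E]
  {Q : Type*} [TopologicalSpace Q] [ChartedSpace E Q]

/-! ### Bundle coordinates on `TQ` -/

/-- The local parametrization of `Q` given by the inverse of the preferred chart at `q`. -/
def baseParam (q : Q) : E → Q := (extChartAt 𝓘(ℝ, E) q).symm

theorem baseParam_mem_source {q : Q} {x : E} (hx : x ∈ (extChartAt 𝓘(ℝ, E) q).target) :
    baseParam q x ∈ (chartAt E q).source := by
  have := (extChartAt 𝓘(ℝ, E) q).map_target hx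
  rwa [extChartAt_source] at this

variable [IsManifold 𝓘(ℝ, E) ∞ Q]

/-- The local parametrization `(x, y) ↦ yⁱ ∂/∂qⁱ|ₓ` of `TQ` given by the inverse of the preferred
chart at `v`. -/
def param (v : TangentBundle 𝓘(ℝ, E) Q) : E × E → TangentBundle 𝓘(ℝ, E) Q :=
  (extChartAt 𝓘(ℝ, E).tangent v).symm

/-- The coordinates of `v` in its own preferred chart. This is the chart through which
`TangentSpace 𝓘(ℝ, E).tangent v` is identified with `E × E`. -/
def coords (v : TangentBundle 𝓘(ℝ, E) Q) : E × E := extChartAt 𝓘(ℝ, E).tangent v v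

/-- The derivative of the parametrization of `Q` at `x`. -/
def baseParamDeriv (q : Q) (x : E) : E →L[ℝ] E := mfderiv 𝓘(ℝ, E) 𝓘(ℝ, E) (baseParam q) x

/-- The derivative of the parametrization of `TQ` at `p`. -/
def paramDeriv (v : TangentBundle 𝓘(ℝ, E) Q) (p : E × E) :
    E × E →L[ℝ] TangentSpace 𝓘(ℝ, E).tangent (param v p) :=
  mfderiv 𝓘(ℝ, E × E) 𝓘(ℝ, E).tangent (param v) p

/-- The coordinate domain of the preferred chart at `v`; it is of the form `U ×ˢ univ`. -/
def dom (v : TangentBundle 𝓘(ℝ, E) Q) : Set (E × E) := (extChartAt 𝓘(ℝ, E).tangent v).target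

theorem isOpen_dom (v : TangentBundle 𝓘(ℝ, E) Q) : IsOpen (dom v) :=
  isOpen_extChartAt_target v

theorem coords_mem_dom (v : TangentBundle 𝓘(ℝ, E) Q) : coords v ∈ dom v :=
  mem_extChartAt_target v

theorem dom_mem_nhds {v : TangentBundle 𝓘(ℝ, E) Q} {p : E × E} (hp : p ∈ dom v) : dom v ∈ nhds p :=
  (isOpen_dom v).mem_nhds hp

theorem param_coords (v : TangentBundle 𝓘(ℝ, E) Q) : param v (coords v) = v :=
  extChartAt_to_inv v

theorem fst_mem_of_mem_dom {v : TangentBundle 𝓘(ℝ, E) Q} {p : E × E} (hp : p ∈ dom v) :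
    p.1 ∈ (extChartAt 𝓘(ℝ, E) v.proj).target := by
  rw [dom, FiberBundle.extChartAt_target] at hp
  exact hp.1.1

theorem mem_dom_of_fst_eq {v : TangentBundle 𝓘(ℝ, E) Q} {p : E × E} (hp : p ∈ dom v) (y : E) :
    (p.1, y) ∈ dom v := by
  rw [dom, FiberBundle.extChartAt_target] at hp ⊢
  exact ⟨hp.1, trivial⟩

theorem contMDiffAt_baseParam {q : Q} {x : E} (hx : x ∈ (extChartAt 𝓘(ℝ, E) q).target) :
    ContMDiffAt 𝓘(ℝ, E) 𝓘(ℝ, E) ∞ (baseParam q) x :=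
  (contMDiffOn_extChartAt_symm q).contMDiffAt (extChartAt_target_mem_nhds' hx)

theorem contMDiffAt_param {v : TangentBundle 𝓘(ℝ, E) Q} {p : E × E} (hp : p ∈ dom v) :
    ContMDiffAt 𝓘(ℝ, E × E) 𝓘(ℝ, E).tangent ∞ (param v) p :=
  (contMDiffOn_extChartAt_symm v).contMDiffAt (dom_mem_nhds hp)

theorem symmL_trivializationAt_eq {q : Q} {x : E} (hx : x ∈ (extChartAt 𝓘(ℝ, E) q).target) :
    ((trivializationAt E (TangentSpace 𝓘(ℝ, E)) q).symmL ℝ (baseParam q x) : E →L[ℝ] E) =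
      baseParamDeriv q x := by
  rw [TangentBundle.symmL_trivializationAt (baseParam_mem_source hx)]
  have : extChartAt 𝓘(ℝ, E) q (baseParam q x) = x := (extChartAt 𝓘(ℝ, E) q).right_inv hx
  rw [this]
  simp only [baseParamDeriv, modelWithCornersSelf_coe, Set.range_id, mfderivWithin_univ]
  rfl

/-- The bundle coordinates `(x, y)` represent the tangent vector `D(baseParam)ₓ y`: in Mathlib the
charts of `TQ` are built from the trivializations of the tangent bundle, whose inverses are the
derivatives of the inverse charts of `Q`. -/
theorem param_eq {v : TangentBundle 𝓘(ℝ, E) Q} {p : E × E} (hp : p ∈ dom v) :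
    param v p = fibreIncl (baseParam v.proj p.1) (baseParamDeriv v.proj p.1 p.2) := by
  have hx := fst_mem_of_mem_dom hp
  rw [← symmL_trivializationAt_eq hx]
  have h := (trivializationAt E (TangentSpace 𝓘(ℝ, E)) v.proj).mk_symm
    (b := baseParam v.proj p.1) (baseParam_mem_source hx) p.2
  rw [← Bundle.Trivialization.symmL_apply (R := ℝ) _ (baseParam_mem_source hx)] at h
  rw [param, FiberBundle.extChartAt]
  exact h.symm

theorem contMDiff_fibreIncl (q : Q) :
    ContMDiff 𝓘(ℝ, E) 𝓘(ℝ, E).tangent ∞ (fibreIncl (E := E) q) := by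
  intro x
  rw [Bundle.contMDiffAt_totalSpace]
  refine ⟨contMDiffAt_const, ?_⟩
  -- in the trivialization at `q`, the inclusion of the fibre over `q` is linear
  have h : (fun y : E =>
      (trivializationAt E (TangentSpace 𝓘(ℝ, E)) q (fibreIncl (E := E) q y)).2) =
      (trivializationAt E (TangentSpace 𝓘(ℝ, E)) q).continuousLinearMapAt ℝ q := by
    ext y
    rw [Bundle.Trivialization.continuousLinearMapAt_apply,
      Bundle.Trivialization.coe_linearMapAt_of_mem _ (mem_chart_source E q)]
    rfl
  change ContMDiffAt 𝓘(ℝ, E) 𝓘(ℝ, E) ∞ (fun y : E =>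
    (trivializationAt E (TangentSpace 𝓘(ℝ, E)) q (fibreIncl (E := E) q y)).2) x
  rw [h]
  exact ContinuousLinearMap.contMDiff (E := E) (F := E) _ |>.contMDiffAt

theorem baseParamDeriv_self (v : TangentBundle 𝓘(ℝ, E) Q) :
    baseParamDeriv v.proj (coords v).1 = ContinuousLinearMap.id ℝ E := by
  have h := mfderivWithin_range_extChartAt_symm (I := 𝓘(ℝ, E)) (x := v.proj)
  simp only [modelWithCornersSelf_coe, Set.range_id, mfderivWithin_univ] at h
  exact h

theorem paramDeriv_self (v : TangentBundle 𝓘(ℝ, E) Q) (u : E × E) :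
    paramDeriv v (coords v) u = u := by
  have h := mfderivWithin_range_extChartAt_symm (I := 𝓘(ℝ, E).tangent) (x := v)
  simp only [ModelWithCorners.range_eq_univ, mfderivWithin_univ] at h
  exact congrArg (fun A : E × E →L[ℝ] E × E => A u) h

theorem coords_snd (v : TangentBundle 𝓘(ℝ, E) Q) : (coords v).2 = v.2 := by
  have h := param_eq (coords_mem_dom v)
  rw [baseParamDeriv_self, param_coords] at h
  have h1 : baseParam v.proj (coords v).1 = v.proj := extChartAt_to_inv v.proj
  rw [h1] at h
  exact (congrArg (fun w : TangentBundle 𝓘(ℝ, E) Q => (w.2 : E)) h).symm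

/-- In bundle coordinates, `Tτ` is the projection `(δx, δy) ↦ δx`. -/
theorem projDeriv_paramDeriv {v : TangentBundle 𝓘(ℝ, E) Q} {p : E × E} (hp : p ∈ dom v)
    (u : E × E) :
    projDeriv (param v p) (paramDeriv v p u) = baseParamDeriv v.proj p.1 u.1 := by
  have hx := fst_mem_of_mem_dom hp
  have h1 := mfderiv_comp_apply (I := 𝓘(ℝ, E × E)) (I' := 𝓘(ℝ, E).tangent) (I'' := 𝓘(ℝ, E)) p
    (g := fun w : TangentBundle 𝓘(ℝ, E) Q => w.proj) (f := param v)
    ((Bundle.contMDiff_proj (n := ∞) (TangentSpace 𝓘(ℝ, E))).mdifferentiableAt (by simp))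
    ((contMDiffAt_param hp).mdifferentiableAt (by simp)) u
  have h2 := mfderiv_comp_apply (I := 𝓘(ℝ, E × E)) (I' := 𝓘(ℝ, E)) (I'' := 𝓘(ℝ, E)) p
    (g := baseParam v.proj) (f := (Prod.fst : E × E → E))
    ((contMDiffAt_baseParam hx).mdifferentiableAt (by simp))
    (differentiableAt_fst.mdifferentiableAt) u
  rw [mfderiv_eq_fderiv, fderiv_fst] at h2
  exact h1.symm.trans h2

/-- In bundle coordinates, the lift of `a` to a vertical vector is `(0, a)`. The reason is that, along
a fibre, `param v (x, y)` is the fibre inclusion composed with the linear map `D(baseParam)ₓ`. -/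
theorem fibreLift_baseParamDeriv {v : TangentBundle 𝓘(ℝ, E) Q} {p : E × E} (hp : p ∈ dom v)
    (a : E) :
    fibreLift (param v p) (baseParamDeriv v.proj p.1 a) = paramDeriv v p (0, a) := by
  have hF : (fibreIncl (baseParam v.proj p.1)) ∘ (baseParamDeriv v.proj p.1) =
      param v ∘ (fun y : E => (p.1, y)) := by
    ext1 y
    exact (param_eq (mem_dom_of_fst_eq hp y)).symm
  have h1 := mfderiv_comp_apply (I := 𝓘(ℝ, E)) (I' := 𝓘(ℝ, E)) (I'' := 𝓘(ℝ, E).tangent) p.2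
    (g := fibreIncl (baseParam v.proj p.1)) (f := baseParamDeriv v.proj p.1)
    ((contMDiff_fibreIncl _).mdifferentiableAt (by simp))
    ((baseParamDeriv v.proj p.1).differentiableAt.mdifferentiableAt) a
  have h2 := mfderiv_comp_apply (I := 𝓘(ℝ, E)) (I' := 𝓘(ℝ, E × E)) (I'' := 𝓘(ℝ, E).tangent) p.2
    (g := param v) (f := fun y : E => (p.1, y))
    ((contMDiffAt_param hp).mdifferentiableAt (by simp))
    (((hasFDerivAt_prodMk_right p.1 p.2).differentiableAt).mdifferentiableAt) a
  rw [mfderiv_eq_fderiv, (hasFDerivAt_prodMk_right p.1 p.2).fderiv] at h2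
  rw [mfderiv_eq_fderiv, ContinuousLinearMap.fderiv] at h1
  rw [hF] at h1
  have h3 := h1.symm.trans h2
  rw [param_eq hp]
  exact h3

/-! ### Differentials of functions in coordinates -/

/-- At the base point of the chart, the differential of `f` is the derivative of its coordinate
expression. Differentiability of `f` need not be assumed separately, as it can be tested in the
chart. -/
theorem mvfderiv_eq_fderiv_param {f : TangentBundle 𝓘(ℝ, E) Q → ℝ}
    {v : TangentBundle 𝓘(ℝ, E) Q} (hf : DifferentiableAt ℝ (f ∘ param v) (coords v)) (u : E × E) :
    mvfderiv 𝓘(ℝ, E).tangent f v u = fderiv ℝ (f ∘ param v) (coords v) u := by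
  have hm : MDifferentiableAt 𝓘(ℝ, E).tangent 𝓘(ℝ, ℝ) f v := by
    have h0 : MDifferentiableAt 𝓘(ℝ, E).tangent 𝓘(ℝ, E × E) (extChartAt 𝓘(ℝ, E).tangent v) v :=
      (contMDiffAt_extChartAt (I := 𝓘(ℝ, E).tangent) (n := ∞) (x := v)).mdifferentiableAt (by simp)
    have h1 : MDifferentiableAt 𝓘(ℝ, E).tangent 𝓘(ℝ, ℝ)
        ((f ∘ param v) ∘ extChartAt 𝓘(ℝ, E).tangent v) v :=
      MDifferentiableAt.comp (I' := 𝓘(ℝ, E × E)) v hf.mdifferentiableAt h0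
    refine h1.congr_of_eventuallyEq ?_
    filter_upwards [extChartAt_source_mem_nhds (I := 𝓘(ℝ, E).tangent) v] with w hw
    have : param v (extChartAt 𝓘(ℝ, E).tangent v w) = w :=
      (extChartAt 𝓘(ℝ, E).tangent v).left_inv hw
    simp only [Function.comp_apply, this]
  have h := hm.mvfderiv
  rw [ModelWithCorners.range_eq_univ, fderivWithin_univ] at h
  exact congrArg (fun A : E × E →L[ℝ] ℝ => A u) h

/-- The chain rule at an arbitrary point of the chart, needed for the functions and forms whose
coordinate expressions are differentiated once more. -/
theorem mvfderiv_paramDeriv {f : TangentBundle 𝓘(ℝ, E) Q → ℝ}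
    (hf : ContMDiff 𝓘(ℝ, E).tangent 𝓘(ℝ, ℝ) ∞ f) {v : TangentBundle 𝓘(ℝ, E) Q} {p : E × E}
    (hp : p ∈ dom v) (u : E × E) :
    mvfderiv 𝓘(ℝ, E).tangent f (param v p) (paramDeriv v p u) = fderiv ℝ (f ∘ param v) p u := by
  have h := mvfderiv_comp_apply (I' := 𝓘(ℝ, E × E)) (I := 𝓘(ℝ, E).tangent) p
    (g := f) (f := param v) (hf.mdifferentiableAt (by simp))
    ((contMDiffAt_param hp).mdifferentiableAt (by simp)) u
  have e : mvfderiv 𝓘(ℝ, E × E) (f ∘ param v) p = fderiv ℝ (f ∘ param v) p := by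
    rw [mvfderiv, mfderiv_eq_fderiv]
    rfl
  exact h.symm.trans (congrArg (fun A : E × E →L[ℝ] ℝ => A u) e)

theorem contDiffAt_comp_param {f : TangentBundle 𝓘(ℝ, E) Q → ℝ}
    (hf : ContMDiff 𝓘(ℝ, E).tangent 𝓘(ℝ, ℝ) ∞ f) {v : TangentBundle 𝓘(ℝ, E) Q} {p : E × E}
    (hp : p ∈ dom v) : ContDiffAt ℝ ∞ (f ∘ param v) p :=
  (hf.contMDiffAt.comp p (contMDiffAt_param hp)).contDiffAt

/-! ### Components of vector fields -/

/-- The components of a vector field `X` in the preferred chart at `q`. -/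
def components (X : ∀ q : Q, TangentSpace 𝓘(ℝ, E) q) (q : Q) (x : E) : E :=
  VectorField.mpullback 𝓘(ℝ, E) 𝓘(ℝ, E) (extChartAt 𝓘(ℝ, E) q).symm X x

theorem isInvertible_baseParamDeriv {q : Q} {x : E} (hx : x ∈ (extChartAt 𝓘(ℝ, E) q).target) :
    (baseParamDeriv q x).IsInvertible := by
  have h := isInvertible_mfderivWithin_extChartAt_symm (I := 𝓘(ℝ, E)) hx
  simp only [modelWithCornersSelf_coe, Set.range_id, mfderivWithin_univ] at h
  exact h

theorem baseParamDeriv_components (X : ∀ q : Q, TangentSpace 𝓘(ℝ, E) q) {q : Q} {x : E}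
    (hx : x ∈ (extChartAt 𝓘(ℝ, E) q).target) :
    baseParamDeriv q x (components X q x) = X (baseParam q x) :=
  (isInvertible_baseParamDeriv hx).self_apply_inverse _

theorem components_self (X : ∀ q : Q, TangentSpace 𝓘(ℝ, E) q) (v : TangentBundle 𝓘(ℝ, E) Q) :
    components X v.proj (coords v).1 = X v.proj := by
  have h := baseParamDeriv_components X (fst_mem_of_mem_dom (coords_mem_dom v))
  rw [baseParamDeriv_self] at h
  have h1 : baseParam v.proj (coords v).1 = v.proj := extChartAt_to_inv v.proj
  rw [h1] at h
  exact h

theorem differentiableAt_components [FiniteDimensional ℝ E] {X : ∀ q : Q, TangentSpace 𝓘(ℝ, E) q}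
    (hX : IsSmoothVectorField X) {q : Q} {x : E}
    (hx : x ∈ (extChartAt 𝓘(ℝ, E) q).target) :
    DifferentiableAt ℝ (components X q) x := by
  have : CompleteSpace E := FiniteDimensional.complete ℝ E
  have h : ContMDiffAt 𝓘(ℝ, E) 𝓘(ℝ, E).tangent 1
      (fun y : E => (⟨y, components (E := E) X q y⟩ : TangentBundle 𝓘(ℝ, E) E)) x :=
    ContMDiffAt.mpullback_vectorField_preimage (m := 1) (n := ∞) (V := X)
      (hX.contMDiffAt.of_le (by exact_mod_cast le_top)) (contMDiffAt_baseParam hx)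
      (isInvertible_baseParamDeriv (E := E) hx) (by norm_cast)
  have h1 := (contMDiff_snd_tangentBundle_modelSpace E 𝓘(ℝ, E) (n := 1)).contMDiffAt
    (x := (⟨x, components (E := E) X q x⟩ : TangentBundle 𝓘(ℝ, E) E))
  have h2 : ContMDiffAt 𝓘(ℝ, E) 𝓘(ℝ, E) 1 (components X q) x :=
    ContMDiffAt.comp (g := fun w : TangentBundle 𝓘(ℝ, E) E => (w.2 : E)) x h1 h
  exact h2.contDiffAt.differentiableAt (by simp)

/-! ### Lifts, the Poincaré–Cartan form and the energy in coordinates -/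

theorem verticalEndomorphism_paramDeriv {v : TangentBundle 𝓘(ℝ, E) Q} {p : E × E} (hp : p ∈ dom v)
    (u : E × E) :
    verticalEndomorphism (param v p) (paramDeriv v p u) = paramDeriv v p (0, u.1) := by
  rw [← fibreLift_baseParamDeriv hp, ← projDeriv_paramDeriv hp]
  rfl

theorem liouville_param {v : TangentBundle 𝓘(ℝ, E) Q} {p : E × E} (hp : p ∈ dom v) :
    liouville (param v p) = paramDeriv v p (0, p.2) := by
  rw [← fibreLift_baseParamDeriv hp, liouville]
  have h : ((param v p).2 : E) = baseParamDeriv v.proj p.1 p.2 :=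
    congrArg (fun w : TangentBundle 𝓘(ℝ, E) Q => (w.2 : E)) (param_eq hp)
  exact congrArg (fibreLift (param v p)) h

theorem verticalLift_param (X : ∀ q : Q, TangentSpace 𝓘(ℝ, E) q)
    {v : TangentBundle 𝓘(ℝ, E) Q} {p : E × E} (hp : p ∈ dom v) :
    verticalLift X (param v p) = paramDeriv v p (0, components X v.proj p.1) := by
  rw [← fibreLift_baseParamDeriv hp, baseParamDeriv_components X (fst_mem_of_mem_dom hp)]
  rfl

/-- `α_L = (∂L/∂q̇ⁱ) dqⁱ`. -/
theorem oneFormInChart_cartanOneForm {L : TangentBundle 𝓘(ℝ, E) Q → ℝ}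
    (hL : ContMDiff 𝓘(ℝ, E).tangent 𝓘(ℝ, ℝ) ∞ L) {v : TangentBundle 𝓘(ℝ, E) Q} {p : E × E}
    (hp : p ∈ dom v) :
    oneFormInChart 𝓘(ℝ, E).tangent (cartanOneForm L) v p =
      (fderiv ℝ (L ∘ param v) p).comp
        ((ContinuousLinearMap.inr ℝ E E).comp (ContinuousLinearMap.fst ℝ E E)) := by
  refine ContinuousLinearMap.ext fun u => ?_
  have h := mvfderiv_paramDeriv hL hp (0, u.1)
  rw [← verticalEndomorphism_paramDeriv hp] at h
  exact h

/-- `E_L = q̇ⁱ ∂L/∂q̇ⁱ - L`. -/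
theorem energy_param {L : TangentBundle 𝓘(ℝ, E) Q → ℝ}
    (hL : ContMDiff 𝓘(ℝ, E).tangent 𝓘(ℝ, ℝ) ∞ L) {v : TangentBundle 𝓘(ℝ, E) Q} {p : E × E}
    (hp : p ∈ dom v) :
    energy L (param v p) = fderiv ℝ (L ∘ param v) p (0, p.2) - (L ∘ param v) p := by
  rw [energy, lieDeriv, liouville_param hp, mvfderiv_paramDeriv hL hp]
  rfl

/-- `X^v(L) = Xⁱ ∂L/∂q̇ⁱ`. -/
theorem lieDeriv_verticalLift_param {L : TangentBundle 𝓘(ℝ, E) Q → ℝ}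
    (hL : ContMDiff 𝓘(ℝ, E).tangent 𝓘(ℝ, ℝ) ∞ L) (X : ∀ q : Q, TangentSpace 𝓘(ℝ, E) q)
    {v : TangentBundle 𝓘(ℝ, E) Q} {p : E × E} (hp : p ∈ dom v) :
    lieDeriv (verticalLift X) L (param v p) =
      fderiv ℝ (L ∘ param v) p (0, components X v.proj p.1) := by
  rw [lieDeriv, verticalLift_param X hp, mvfderiv_paramDeriv hL hp]

/-! ### Second derivatives of the Lagrangian -/

/-- The second derivative at `v` of the coordinate expression of `L` in the preferred chart. -/
def secondDeriv (L : TangentBundle 𝓘(ℝ, E) Q → ℝ) (v : TangentBundle 𝓘(ℝ, E) Q) :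
    E × E →L[ℝ] E × E →L[ℝ] ℝ :=
  fderiv ℝ (fderiv ℝ (L ∘ param v)) (coords v)

variable {L : TangentBundle 𝓘(ℝ, E) Q → ℝ}

theorem secondDeriv_comm (hL : ContMDiff 𝓘(ℝ, E).tangent 𝓘(ℝ, ℝ) ∞ L)
    (v : TangentBundle 𝓘(ℝ, E) Q) (a b : E × E) :
    secondDeriv L v a b = secondDeriv L v b a :=
  ((contDiffAt_comp_param hL (coords_mem_dom v)).isSymmSndFDerivAt (by
    rw [minSmoothness_of_isRCLikeNormedField]
    norm_cast)) a b

theorem hasFDerivAt_fderiv_comp_param (hL : ContMDiff 𝓘(ℝ, E).tangent 𝓘(ℝ, ℝ) ∞ L)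
    (v : TangentBundle 𝓘(ℝ, E) Q) :
    HasFDerivAt (fderiv ℝ (L ∘ param v)) (secondDeriv L v) (coords v) := by
  have h := (contDiffAt_comp_param hL (coords_mem_dom v)).fderiv_right (m := 1) (by norm_cast)
  exact (h.differentiableAt (by simp)).hasFDerivAt

theorem hasFDerivAt_comp_param (hL : ContMDiff 𝓘(ℝ, E).tangent 𝓘(ℝ, ℝ) ∞ L)
    (v : TangentBundle 𝓘(ℝ, E) Q) :
    HasFDerivAt (L ∘ param v) (fderiv ℝ (L ∘ param v) (coords v)) (coords v) :=
  ((contDiffAt_comp_param hL (coords_mem_dom v)).differentiableAt (by simp)).hasFDerivAt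

/-- The fibre Hessian is the vertical block of the second derivative of `L` in coordinates. -/
theorem fibreHessian_apply (hL : ContMDiff 𝓘(ℝ, E).tangent 𝓘(ℝ, ℝ) ∞ L)
    (v : TangentBundle 𝓘(ℝ, E) Q) (a b : E) :
    fibreHessian L v a b = secondDeriv L v (0, a) (0, b) := by
  have hF : (fun x : E => L (fibreIncl (E := E) v.proj x)) =
      (L ∘ param v) ∘ fun y : E => ((coords v).1, y) := by
    ext1 y
    have h := param_eq (mem_dom_of_fst_eq (coords_mem_dom v) y)
    rw [baseParamDeriv_self] at h
    have h1 : baseParam v.proj (coords v).1 = v.proj := extChartAt_to_inv v.proj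
    rw [h1] at h
    exact congrArg L h.symm
  have hd : fderiv ℝ (fun x : E => L (fibreIncl (E := E) v.proj x)) =
      fun y => (fderiv ℝ (L ∘ param v) ((coords v).1, y)).comp (ContinuousLinearMap.inr ℝ E E) := by
    rw [hF]
    ext1 y
    have h := contDiffAt_comp_param hL (mem_dom_of_fst_eq (coords_mem_dom v) y)
    exact ((h.differentiableAt (by simp)).hasFDerivAt.comp y
      (hasFDerivAt_prodMk_right (𝕜 := ℝ) (coords v).1 y)).fderiv
  have h2 : HasFDerivAt (fun y => fderiv ℝ (L ∘ param v) ((coords v).1, y))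
      ((secondDeriv L v).comp (ContinuousLinearMap.inr ℝ E E)) (coords v).2 :=
    (hasFDerivAt_fderiv_comp_param hL v).comp (coords v).2
      (hasFDerivAt_prodMk_right (𝕜 := ℝ) (coords v).1 (coords v).2)
  have h3 := h2.clm_comp (hasFDerivAt_const (ContinuousLinearMap.inr ℝ E E) (coords v).2)
  have h4 : fibreHessian L v = fderiv ℝ (fderiv ℝ fun x : E => L (fibreIncl (E := E) v.proj x))
      (coords v).2 := by
    rw [coords_snd]
    rfl
  rw [h4, hd, h3.fderiv]
  simp

/-- In coordinates `α_L` at `p` is `b ↦ DL(p)(0, b.1)`, so `-dα_L` is the antisymmetrization of the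
second derivative of `L` composed with `b ↦ (0, b.1)`. -/
theorem cartanTwoForm_apply (hL : ContMDiff 𝓘(ℝ, E).tangent 𝓘(ℝ, ℝ) ∞ L)
    (v : TangentBundle 𝓘(ℝ, E) Q) (a b : E × E) :
    cartanTwoForm L v ![a, b] = secondDeriv L v b (0, a.1) - secondDeriv L v a (0, b.1) := by
  have heq : oneFormInChart 𝓘(ℝ, E).tangent (cartanOneForm L) v =ᶠ[nhds (coords v)] fun p =>
      (fderiv ℝ (L ∘ param v) p).comp
        ((ContinuousLinearMap.inr ℝ E E).comp (ContinuousLinearMap.fst ℝ E E)) := by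
    filter_upwards [dom_mem_nhds (coords_mem_dom v)] with p hp
    exact oneFormInChart_cartanOneForm hL hp
  have hd := ((hasFDerivAt_fderiv_comp_param hL v).clm_comp (hasFDerivAt_const
    ((ContinuousLinearMap.inr ℝ E E).comp (ContinuousLinearMap.fst ℝ E E))
      (coords v))).congr_of_eventuallyEq heq
  have hω : HasFDerivAt (fun p => ContinuousAlternatingMap.ofSubsingleton ℝ (E × E) ℝ (0 : Fin 1)
      (oneFormInChart 𝓘(ℝ, E).tangent (cartanOneForm L) v p)) _ (coords v) :=
    (ContinuousAlternatingMap.ofSubsingletonLIE (𝕜 := ℝ) (E := E × E) (F := ℝ)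
      (0 : Fin 1)).toContinuousLinearEquiv.toContinuousLinearMap.hasFDerivAt.comp (coords v) hd
  have hw (w c : E × E) : fderiv ℝ
      (fun p => oneFormInChart 𝓘(ℝ, E).tangent (cartanOneForm L) v p w) (coords v) c =
        secondDeriv L v c (0, w.1) := by
    rw [(hd.clm_apply (hasFDerivAt_const w (coords v))).fderiv]
    simp
  have h : extDerivOneForm 𝓘(ℝ, E).tangent (cartanOneForm L) v ![a, b] =
      secondDeriv L v a (0, b.1) - secondDeriv L v b (0, a.1) := by
    refine (extDeriv_apply hω.differentiableAt ![a, b]).trans ?_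
    rw [Fin.sum_univ_two]
    change (-1) ^ 0 • fderiv ℝ
        (fun p => oneFormInChart 𝓘(ℝ, E).tangent (cartanOneForm L) v p b) (coords v) a +
      (-1) ^ 1 • fderiv ℝ
        (fun p => oneFormInChart 𝓘(ℝ, E).tangent (cartanOneForm L) v p a) (coords v) b = _
    rw [hw, hw]
    simp [sub_eq_add_neg]
  have h' : cartanTwoForm L v ![a, b] =
      -(extDerivOneForm 𝓘(ℝ, E).tangent (cartanOneForm L) v ![a, b]) := rfl
  rw [h', h, neg_sub]

/-- The differential of `E_L`: the two terms `∂L/∂q̇ⁱ dq̇ⁱ` coming from `Δ(L)` and from `L` cancel. -/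
theorem mvfderiv_energy (hL : ContMDiff 𝓘(ℝ, E).tangent 𝓘(ℝ, ℝ) ∞ L)
    (v : TangentBundle 𝓘(ℝ, E) Q) (u : E × E) :
    mvfderiv 𝓘(ℝ, E).tangent (energy L) v u =
      secondDeriv L v u (0, v.2) - fderiv ℝ (L ∘ param v) (coords v) (u.1, 0) := by
  have heq : energy L ∘ param v =ᶠ[nhds (coords v)] fun p =>
      fderiv ℝ (L ∘ param v) p (0, p.2) - (L ∘ param v) p := by
    filter_upwards [dom_mem_nhds (coords_mem_dom v)] with p hp
    exact energy_param hL hp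
  have hs : HasFDerivAt (fun p : E × E => ((0 : E), p.2))
      ((ContinuousLinearMap.inr ℝ E E).comp (ContinuousLinearMap.snd ℝ E E)) (coords v) :=
    ((ContinuousLinearMap.inr ℝ E E).comp (ContinuousLinearMap.snd ℝ E E)).hasFDerivAt
  have hd := (((hasFDerivAt_fderiv_comp_param hL v).clm_apply hs).sub
    (hasFDerivAt_comp_param hL v)).congr_of_eventuallyEq heq
  rw [mvfderiv_eq_fderiv_param hd.differentiableAt, hd.fderiv, ← coords_snd]
  have hu : u = (u.1, 0) + (0, u.2) := by simp
  have := congrArg (fderiv ℝ (L ∘ param v) (coords v)) hu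
  rw [map_add] at this
  simp [this]
  ring

/-- The product rule for `Xⁱ ∂L/∂q̇ⁱ`, where the components `Xⁱ` depend on the base point only. -/
theorem mvfderiv_lieDeriv_verticalLift [FiniteDimensional ℝ E]
    (hL : ContMDiff 𝓘(ℝ, E).tangent 𝓘(ℝ, ℝ) ∞ L) {X : ∀ q : Q, TangentSpace 𝓘(ℝ, E) q}
    (hX : IsSmoothVectorField X) (v : TangentBundle 𝓘(ℝ, E) Q) (u : E × E) :
    mvfderiv 𝓘(ℝ, E).tangent (lieDeriv (verticalLift X) L) v u =
      secondDeriv L v u (0, components X v.proj (coords v).1) + fderiv ℝ (L ∘ param v) (coords v)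
        (0, fderiv ℝ (components X v.proj) (coords v).1 u.1) := by
  have heq : lieDeriv (verticalLift X) L ∘ param v =ᶠ[nhds (coords v)] fun p =>
      fderiv ℝ (L ∘ param v) p (0, components X v.proj p.1) := by
    filter_upwards [dom_mem_nhds (coords_mem_dom v)] with p hp
    exact lieDeriv_verticalLift_param hL X hp
  have hc := (differentiableAt_components hX
    (fst_mem_of_mem_dom (coords_mem_dom v))).hasFDerivAt.comp (coords v) hasFDerivAt_fst
  have hs := (hasFDerivAt_const (0 : E) (coords v)).prodMk hc
  have hd := ((hasFDerivAt_fderiv_comp_param hL v).clm_apply hs).congr_of_eventuallyEq heq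
  rw [mvfderiv_eq_fderiv_param hd.differentiableAt, hd.fderiv]
  exact add_comm _ _

/-! ### The forced Euler–Lagrange equations -/

theorem projDeriv_apply (v : TangentBundle 𝓘(ℝ, E) Q) (u : E × E) : projDeriv v u = u.1 := by
  let F : TangentBundle 𝓘(ℝ, E) Q → E × E →L[ℝ] E := fun w => projDeriv w
  have h : F (param v (coords v)) (paramDeriv v (coords v) u) =
      baseParamDeriv v.proj (coords v).1 u.1 := projDeriv_paramDeriv (coords_mem_dom v) u
  rw [baseParamDeriv_self, param_coords] at h
  exact (congrArg (F v) (paramDeriv_self v u)).symm.trans h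

/-- The covector `α v`, read in the coordinates of the preferred chart at `v`. -/
def formCoords (α : ∀ v : TangentBundle 𝓘(ℝ, E) Q, TangentSpace 𝓘(ℝ, E).tangent v →L[ℝ] ℝ)
    (v : TangentBundle 𝓘(ℝ, E) Q) : E × E →L[ℝ] ℝ :=
  α v

theorem IsSemibasic.apply_eq
    {β : ∀ v : TangentBundle 𝓘(ℝ, E) Q, TangentSpace 𝓘(ℝ, E).tangent v →L[ℝ] ℝ}
    (hβ : IsSemibasic β) (v : TangentBundle 𝓘(ℝ, E) Q) (u : E × E) :
    formCoords β v u = formCoords β v (u.1, 0) := by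
  have h : formCoords β v (0, u.2) = 0 := hβ v (0, u.2) (projDeriv_apply v (0, u.2))
  have hu : u = (u.1, 0) + (0, u.2) := by simp
  calc formCoords β v u = formCoords β v ((u.1, 0) + (0, u.2)) := congrArg _ hu
    _ = formCoords β v (u.1, 0) + formCoords β v (0, u.2) := map_add _ _ _
    _ = _ := by rw [h, add_zero]

/-- The covector `∂L/∂qⁱ - βᵢ` at `v`, in the coordinates of the preferred chart: the right-hand side
of the forced Euler–Lagrange equations `d/dt (∂L/∂q̇ⁱ) = ∂L/∂qⁱ - βᵢ`. -/
def eulerLagrangeForce (L : TangentBundle 𝓘(ℝ, E) Q → ℝ)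
    (β : ∀ v : TangentBundle 𝓘(ℝ, E) Q, TangentSpace 𝓘(ℝ, E).tangent v →L[ℝ] ℝ)
    (v : TangentBundle 𝓘(ℝ, E) Q) : E →L[ℝ] ℝ :=
  (fderiv ℝ (L ∘ param v) (coords v) - formCoords β v).comp (ContinuousLinearMap.inl ℝ E E)

/-- At each point, the equation `i_ξ ω_L = dE_L + β` says that `ξ` is of second order, with the same
base component as the velocity, and that it satisfies the forced Euler–Lagrange equations. -/
theorem eulerLagrange_at_iff (hL : ContMDiff 𝓘(ℝ, E).tangent 𝓘(ℝ, ℝ) ∞ L) (hreg : IsRegular L)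
    {β : ∀ v : TangentBundle 𝓘(ℝ, E) Q, TangentSpace 𝓘(ℝ, E).tangent v →L[ℝ] ℝ}
    (hβ : IsSemibasic β) (v : TangentBundle 𝓘(ℝ, E) Q) (z : E × E) :
    (∀ u : E × E, cartanTwoForm L v ![z, u] =
      mvfderiv 𝓘(ℝ, E).tangent (energy L) v u + formCoords β v u) ↔
    z.1 = v.2 ∧ ∀ w : E, secondDeriv L v z (0, w) = eulerLagrangeForce L β v w := by
  have hf (w : E) : eulerLagrangeForce L β v w =
      fderiv ℝ (L ∘ param v) (coords v) (w, 0) - formCoords β v (w, 0) := rfl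
  have key (u : E × E) : (cartanTwoForm L v ![z, u] =
      mvfderiv 𝓘(ℝ, E).tangent (energy L) v u + formCoords β v u) ↔
      secondDeriv L v u (0, z.1) - secondDeriv L v z (0, u.1) =
        secondDeriv L v u (0, (coords v).2) - eulerLagrangeForce L β v u.1 := by
    rw [cartanTwoForm_apply hL, mvfderiv_energy hL, hβ.apply_eq, hf, coords_snd]
    constructor <;> intro h <;> linear_combination h
  simp only [key]
  rw [← coords_snd]
  constructor
  · intro h
    -- Testing on vertical `u = (0, w)` gives the second-order condition by regularity; testing on
    -- `u = (w, 0)` then gives the Euler–Lagrange equations.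
    have h1 : z.1 = (coords v).2 := by
      have hW : fibreHessian L v z.1 = fibreHessian L v (coords v).2 := by
        ext w
        have := h (0, w)
        rw [show ((0, ((0, w) : E × E).1) : E × E) = 0 from rfl] at this
        rw [fibreHessian_apply hL, fibreHessian_apply hL, secondDeriv_comm hL,
          secondDeriv_comm hL v (0, (coords v).2)]
        simpa using this
      exact (hreg v).injective hW
    refine ⟨h1, fun w => ?_⟩
    have := h (w, 0)
    rw [h1] at this
    linarith
  · rintro ⟨h1, h2⟩ u
    rw [h1, h2]

/-- The second-order condition fixes the base component of `z`; the remaining equations are linear in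
the fibre component, with the invertible fibre Hessian as matrix. -/
theorem existsUnique_eulerLagrange_at (hL : ContMDiff 𝓘(ℝ, E).tangent 𝓘(ℝ, ℝ) ∞ L)
    (hreg : IsRegular L) (v : TangentBundle 𝓘(ℝ, E) Q) (f : E →L[ℝ] ℝ) :
    ∃! z : E × E, z.1 = v.2 ∧ ∀ w : E, secondDeriv L v z (0, w) = f w := by
  have hsplit (a x w : E) : secondDeriv L v (a, x) (0, w) =
      secondDeriv L v (a, 0) (0, w) + fibreHessian L v x w := by
    rw [fibreHessian_apply hL, ← add_apply, ← map_add]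
    simp
  let g : E →L[ℝ] ℝ := f - (secondDeriv L v ((coords v).2, 0)).comp (ContinuousLinearMap.inr ℝ E E)
  rw [← coords_snd]
  refine ⟨((coords v).2, (fibreHessian L v).inverse g), ⟨rfl, fun w => ?_⟩, ?_⟩
  · rw [hsplit, (hreg v).self_apply_inverse]
    simp [g]
  · rintro ⟨a, x⟩ ⟨ha, h⟩
    obtain rfl : a = (coords v).2 := ha
    have hW : fibreHessian L v x = g := by
      ext w
      have := h w
      rw [hsplit] at this
      simp only [g, sub_apply, ContinuousLinearMap.comp_apply, ContinuousLinearMap.inr_apply]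
      linarith
    rw [← hW, (hreg v).inverse_apply_self]

theorem completeLift_eq (X : ∀ q : Q, TangentSpace 𝓘(ℝ, E) q) (v : TangentBundle 𝓘(ℝ, E) Q) :
    (completeLift X v : E × E) =
      (components X v.proj (coords v).1, fderiv ℝ (components X v.proj) (coords v).1 v.2) :=
  Prod.ext (components_self X v).symm rfl

/-- Along a solution, `ξ(Xⁱ ∂L/∂q̇ⁱ) = Xⁱ ξ(∂L/∂q̇ⁱ) + q̇ʲ (∂Xⁱ/∂qʲ) ∂L/∂q̇ⁱ` by the second-order
condition, and the Euler–Lagrange equations replace `ξ(∂L/∂q̇ⁱ)` by `∂L/∂qⁱ - βᵢ`. -/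
theorem lieDeriv_lieDeriv_verticalLift [FiniteDimensional ℝ E]
    (hL : ContMDiff 𝓘(ℝ, E).tangent 𝓘(ℝ, ℝ) ∞ L) (hreg : IsRegular L)
    {β : ∀ v : TangentBundle 𝓘(ℝ, E) Q, TangentSpace 𝓘(ℝ, E).tangent v →L[ℝ] ℝ}
    (hβ : IsSemibasic β)
    {ξ : ∀ v : TangentBundle 𝓘(ℝ, E) Q, TangentSpace 𝓘(ℝ, E).tangent v}
    (hξ : IsForcedEulerLagrange L β ξ)
    {X : ∀ q : Q, TangentSpace 𝓘(ℝ, E) q} (hX : IsSmoothVectorField X)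
    (v : TangentBundle 𝓘(ℝ, E) Q) :
    lieDeriv ξ (lieDeriv (verticalLift X) L) v =
      lieDeriv (completeLift X) L v - β v (completeLift X v) := by
  obtain ⟨h1, h2⟩ := (eulerLagrange_at_iff hL hreg hβ v (ξ v)).1 (hξ v)
  have h3 : lieDeriv ξ (lieDeriv (verticalLift X) L) v = _ :=
    mvfderiv_lieDeriv_verticalLift hL hX v (ξ v)
  have h4 : lieDeriv (completeLift X) L v =
      fderiv ℝ (L ∘ param v) (coords v) (completeLift X v) :=
    mvfderiv_eq_fderiv_param (hasFDerivAt_comp_param hL v).differentiableAt (completeLift X v)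
  have h5 : β v (completeLift X v) = formCoords β v (components X v.proj (coords v).1, 0) :=
    (hβ.apply_eq v (completeLift X v)).trans
      (congrArg (fun u : E × E => formCoords β v (u.1, 0)) (completeLift_eq X v))
  have h6 : fderiv ℝ (L ∘ param v) (coords v) (completeLift X v) =
      fderiv ℝ (L ∘ param v) (coords v) (components X v.proj (coords v).1, 0) +
        fderiv ℝ (L ∘ param v) (coords v)
          (0, fderiv ℝ (components X v.proj) (coords v).1 v.2) := by
    rw [← map_add, Prod.mk_add_mk, add_zero, zero_add]
    exact congrArg (fderiv ℝ (L ∘ param v) (coords v)) (completeLift_eq X v)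
  have h7 (w : E) : eulerLagrangeForce L β v w =
      fderiv ℝ (L ∘ param v) (coords v) (w, 0) - formCoords β v (w, 0) := rfl
  rw [h3, h4, h5, h6, h2, h1, h7]
  ring

end ForcedLagrangian

end

theorem theorem1
    {E : Type*} [NormedAddCommGroup E] [NormedSpace ℝ E] [FiniteDimensional ℝ E]
    {Q : Type*} [TopologicalSpace Q] [ChartedSpace E Q] [IsManifold 𝓘(ℝ, E) ∞ Q]
    (L : TangentBundle 𝓘(ℝ, E) Q → ℝ)
    (hL : ContMDiff 𝓘(ℝ, E).tangent 𝓘(ℝ, ℝ) ∞ L)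
    (hreg : ForcedLagrangian.IsRegular L)
    (β : ∀ v : TangentBundle 𝓘(ℝ, E) Q, TangentSpace 𝓘(ℝ, E).tangent v →L[ℝ] ℝ)
    (hβ : ForcedLagrangian.IsSmoothOneForm 𝓘(ℝ, E).tangent β)
    (hβ' : ForcedLagrangian.IsSemibasic β) :
    (∃! ξ : (∀ v : TangentBundle 𝓘(ℝ, E) Q, TangentSpace 𝓘(ℝ, E).tangent v),
      ForcedLagrangian.IsForcedEulerLagrange L β ξ) ∧
    ∀ ξ : (∀ v : TangentBundle 𝓘(ℝ, E) Q, TangentSpace 𝓘(ℝ, E).tangent v),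
      ForcedLagrangian.IsForcedEulerLagrange L β ξ →
      ∀ X : (∀ q : Q, TangentSpace 𝓘(ℝ, E) q), ForcedLagrangian.IsSmoothVectorField X →
        (∀ v : TangentBundle 𝓘(ℝ, E) Q,
          ForcedLagrangian.lieDeriv ξ
              (ForcedLagrangian.lieDeriv (ForcedLagrangian.verticalLift X) L) v =
            ForcedLagrangian.lieDeriv (ForcedLagrangian.completeLift X) L v -
              β v (ForcedLagrangian.completeLift X v)) ∧
        ((∀ v : TangentBundle 𝓘(ℝ, E) Q,
            ForcedLagrangian.lieDeriv (ForcedLagrangian.completeLift X) L v =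
              β v (ForcedLagrangian.completeLift X v)) ↔
          ForcedLagrangian.IsConstantOfMotion ξ
            (ForcedLagrangian.lieDeriv (ForcedLagrangian.verticalLift X) L)) := by
  refine ⟨?_, fun ξ hξ X hX => ?_⟩
  · choose ξ hξ huniq using fun v : TangentBundle 𝓘(ℝ, E) Q =>
      ForcedLagrangian.existsUnique_eulerLagrange_at hL hreg v
        (ForcedLagrangian.eulerLagrangeForce L β v)
    exact ⟨ξ, fun v => (ForcedLagrangian.eulerLagrange_at_iff hL hreg hβ' v (ξ v)).2 (hξ v),
      fun η hη => funext fun v => huniq v (η v)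
        ((ForcedLagrangian.eulerLagrange_at_iff hL hreg hβ' v (η v)).1 (hη v))⟩
  · have key := ForcedLagrangian.lieDeriv_lieDeriv_verticalLift hL hreg hβ' hξ hX
    refine ⟨key, fun h v => ?_, fun h v => ?_⟩
    · rw [key v, h v, sub_self]
    · exact sub_eq_zero.1 ((key v).symm.trans (h v))
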